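/- Let $X$ be a real Banach space, let $\Psi : X \to [0,\infty]$ and $\Phi : X \to \mathbb{R}$, write $D(\Psi) = \{u \in X : \Psi(u) < \infty\}$, and for $\lambda > 0$ put $I_\lambda = \lambda\Psi - \Phi : X \to (-\infty,\infty]$. Call $u \in X$ a critical point of $I_\lambda$ (in the sense of Szulkin) if $$\lambda\,(\Psi(v) - \Psi(u)) - \Phi'(u)(v-u) \ge 0 \quad \text{for all } v \in X$$ (in particular $u \in D(\Psi)$). Assume: - $(\Psi_1)$ $\Psi$ is lower semicontinuous and convex, and $\Psi(0) = 0$; - $(\Psi_2)$ $\Psi(u) \to \infty$ as $\|u\| \to \infty$; - $(\Psi_3)$ if $\{u_j\}_{j\ge1} \subset D(\Psi)$ and $u \in D(\Psi)$ satisfy $u_j \rightharpoonup u$ weakly in $X$ and $\Psi(u_j) \to \Psi(u)$, then $\|u_j - u\| \to 0$; - $(\Phi_1)$ $\Phi \in C^1(X,\mathbb{R})$; - $(\Phi_2)$ every bounded sequence $\{u_l\}$ in $X$ has a subsequence $\{u_{l_j}\}$ converging weakly to some $u \in X$ such that $\liminf_{j\to\infty} \Phi'(u_{l_j})(v - u_{l_j})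 \ge \Phi'(u)(v-u)$ for every $v \in X$; - (IB) for all $0 < a \le b < \infty$ and $c \in \mathbb{R}$, the set $$\mathcal{K}^c_{[a,b]} = \{u \in X : \text{for some } \lambda \in [a,b],\ u \text{ is a critical point of } I_\lambda \text{ with } I_\lambda(u) \le c\}$$ is bounded in $X$; - (MP) there are $\rho_0, \alpha_0 > 0$, $\bar\varepsilon \in (0,1)$ and $u_0 \in X$ such that $$\inf_{\|u\| = \rho_0} I_{1-\bar\varepsilon}(u) = \alpha_0 > 0, \qquad \|u_0\| > \rho_0, \qquad \max\{I_{1+\bar\varepsilon}(0),\ I_{1+\bar\varepsilon}(u_0)\} \le 0.$$ Let $$c_0(1) = \inf_{\gamma \in \Gamma_0}\ \sup_{t \in [0,1]} I_1(\gamma(t)), \qquad \Gamma_0 = \{\gamma \in C([0,1],X) : \gamma(0) = 0,\ \gamma(1) = u_0\}.$$ Then $I = I_1 = \Psi - \Phi$ has a critical point $u \in X$ with $I(u) = c_0(1)$. -/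

import Mathlib

open Set Filter Topology
open scoped ENNReal NNReal

namespace MountainPass

variable {X : Type*} [NormedAddCommGroup X] [NormedSpace ℝ X]

/-- Weak convergence `u j ⇀ w` of a sequence in a real normed space. -/
def WeaklyConverges (u : ℕ → X) (w : X) : Prop :=
  Tendsto (fun j => toWeakSpace ℝ X (u j)) atTop (𝓝 (toWeakSpace ℝ X w))

/-- The functional `I_λ = λ Ψ - Φ`, with values in the extended reals. -/
noncomputable def energy (Ψ : X → ℝ≥0∞) (Φ : X → ℝ) (lam : ℝ) (u : X) : EReal :=
  (lam : EReal) * (Ψ u : EReal) - ((Φ u : ℝ) : EReal)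

/-- `u` is a critical point, in the sense of Szulkin, of `I_λ = λ Ψ - Φ` (for `λ > 0`):
`λ (Ψ v - Ψ u) - Φ'(u)(v - u) ≥ 0` for all `v`. In `EReal` one has `⊤ - ⊤ = ⊥`, so (taking
`v = u`) the condition forces `Ψ u < ∞`, and then no indeterminate form occurs. -/
def IsCriticalPoint (Ψ : X → ℝ≥0∞) (Φ : X → ℝ) (lam : ℝ) (u : X) : Prop :=
  ∀ v : X, 0 ≤ (lam : EReal) * ((Ψ v : EReal) - (Ψ u : EReal))
    - ((fderiv ℝ Φ u (v - u) : ℝ) : EReal)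

/-- The set `K^c_{[a,b]}` of all critical points `u` of some `I_λ`, `λ ∈ [a,b]`,
with `I_λ u ≤ c`. -/
def criticalSet (Ψ : X → ℝ≥0∞) (Φ : X → ℝ) (a b c : ℝ) : Set X :=
  {u | ∃ lam ∈ Icc a b, IsCriticalPoint Ψ Φ lam u ∧ energy Ψ Φ lam u ≤ (c : EReal)}

/-- Uniform mountain pass geometry of `I_λ` for `λ` close to `1`. -/
structure UniformMountainPassGeometry (Ψ : X → ℝ≥0∞) (Φ : X → ℝ)
    (ρ₀ α₀ ε : ℝ) (u₀ : X) : Prop where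
  radius_pos : 0 < ρ₀
  height_pos : 0 < α₀
  eps_pos : 0 < ε
  /-- `1 - ε` is an admissible (positive) parameter of the family `I_λ`. -/
  eps_lt_one : ε < 1
  iInf_sphere : ⨅ u ∈ Metric.sphere (0 : X) ρ₀, energy Ψ Φ (1 - ε) u = (α₀ : EReal)
  radius_lt_norm : ρ₀ < ‖u₀‖
  endpoints : max (energy Ψ Φ (1 + ε) 0) (energy Ψ Φ (1 + ε) u₀) ≤ 0

/-- The mountain pass value `c₀(λ)`: infimum over all continuous paths `γ : [0,1] → X` from `0`
to `u₀` of the supremum of `I_λ` along `γ`. -/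
noncomputable def mountainPassLevel (Ψ : X → ℝ≥0∞) (Φ : X → ℝ) (u₀ : X) (lam : ℝ) : EReal :=
  ⨅ γ : Path (0 : X) u₀, ⨆ t : unitInterval, energy Ψ Φ lam (γ t)

end MountainPass

/-!
The proof is a monotonicity trick for functionals whose nonsmooth part is only lower
semicontinuous. The level `c(λ)` of `I_λ = λ Ψ - Φ` is nondecreasing in `λ`, hence differentiable at
parameters `λ > 1` arbitrarily close to `1`. At such a `λ` there is a critical point of `I_λ` at
level `c(λ)` (`exists_critical_of_right_deriv`). These critical points form a bounded family by
hypothesis, so that they subconverge, as `λ ↓ 1`, to a critical point of `I_1`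
(`exists_subseq_tendsto`); its level is `c(1)` because `c` is right-continuous at `1`
(`tendsto_level`).

To find a critical point at a point `λ` of differentiability, take `μ ↓ λ` and apply Ekeland's
principle, on the complete space of paths, to `γ ↦ sup I_λ ∘ γ + sup I_μ ∘ γ`
(`exists_almost_critical`). This sum is bounded below by `c(λ) + c(μ)`, and a path nearly optimal
for `μ` makes it at most about `2 c(μ)`; so on the Ekeland path `I_μ` stays below
`2 c(μ) - c(λ)` approximately, and at a point where `I_λ` is nearly `c(λ)` one gets
`(μ - λ) Ψ ≤ 2 (c(μ) - c(λ)) + O(μ - λ) = O(μ - λ)`. That bounds `Ψ`, and by coercivity the norm.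
At some such point every test vector satisfies the variational inequality, up to a small error, for
`λ` or for `μ`, which in the limit `μ ↓ λ` is the same: otherwise the path could be deformed
(`exists_deformation`) so that the sum decreases too fast. The deformation moves each point
towards a continuous selection of convex sets of descent directions. Since `Ψ` need not be
continuous along the path, a point where `I_λ` is low may be close to points where it is high;
such a low point is then itself a direction of descent for its high neighbours, and moving towards
it raises `I_μ` by an arbitrarily small amount only, which is all that the sum of the two
suprema requires.
-/

namespace MountainPass

/-! ### Ekeland's variational principle -/

/-- Ekeland's variational principle in its weak form: a lower semicontinuous function bounded below
has, for every `δ > 0`, a point below the given one where it cannot decrease at rate more than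
`δ`. -/
theorem exists_ekeland_point {α : Type*} [MetricSpace α] [CompleteSpace α] {f : α → ℝ}
    (hf : LowerSemicontinuous f) {m : ℝ} (hm : ∀ x, m ≤ f x) (x₀ : α) {δ : ℝ} (hδ : 0 < δ) :
    ∃ x, f x ≤ f x₀ ∧ ∀ y, f x ≤ f y + δ * dist x y := by
  let S : α → Set α := fun x => {y | f y + δ * dist x y ≤ f x}
  have hself : ∀ x, x ∈ S x := fun x => by simp [S]
  have htrans : ∀ {x y z}, y ∈ S x → z ∈ S y → z ∈ S x := by
    intro x y z hy hz
    have h := mul_le_mul_of_nonneg_left (dist_triangle x y z) hδ.le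
    change f y + δ * dist x y ≤ f x at hy
    change f z + δ * dist y z ≤ f y at hz
    change f z + δ * dist x z ≤ f x
    linarith
  have hbdd : ∀ x, BddBelow (f '' S x) := fun x => ⟨m, by rintro _ ⟨y, -, rfl⟩; exact hm y⟩
  have hstep : ∀ (n : ℕ) (x : α), ∃ y ∈ S x, ∀ z ∈ S x, f y ≤ f z + (1 / 2) ^ n := by
    intro n x
    have hlt : sInf (f '' S x) < sInf (f '' S x) + (1 / 2) ^ n := by
      have : (0 : ℝ) < (1 / 2) ^ n := by positivity
      linarith
    obtain ⟨_, ⟨y, hy, rfl⟩, hy'⟩ := exists_lt_of_csInf_lt ⟨_, mem_image_of_mem f (hself x)⟩ hlt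
    exact ⟨y, hy, fun z hz => by linarith [csInf_le (hbdd x) (mem_image_of_mem f hz)]⟩
  choose next hnext hnext' using hstep
  let x : ℕ → α := fun n => Nat.rec x₀ (fun n y => next n y) n
  have hxs : ∀ n, x (n + 1) ∈ S (x n) := fun n => hnext n (x n)
  have hmem : ∀ n k, x (n + k) ∈ S (x n) := by
    intro n k
    induction k with
    | zero => exact hself _
    | succ k ih => exact htrans ih (hxs (n + k))
  -- every later choice, limits included, is at most `2 ^ (-n) / δ` away from the `n + 1`-st one
  have hsmall : ∀ n, ∀ z ∈ S (x (n + 1)), δ * dist (x (n + 1)) z ≤ (1 / 2) ^ n := by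
    intro n z hz
    have h1 : f (x (n + 1)) ≤ f z + (1 / 2) ^ n := hnext' n (x n) z (htrans (hxs n) hz)
    have h2 : f z + δ * dist (x (n + 1)) z ≤ f (x (n + 1)) := hz
    linarith
  have hlim : Tendsto (fun n : ℕ => ((1 : ℝ) / 2) ^ n / δ) atTop (𝓝 0) := by
    simpa using (tendsto_pow_atTop_nhds_zero_of_lt_one (by norm_num : (0 : ℝ) ≤ 1 / 2)
      (by norm_num)).div_const δ
  have hcau : CauchySeq fun n => x (n + 1) := by
    refine cauchySeq_of_le_tendsto_0' (fun n => (1 / 2) ^ n / δ) (fun n k hnk => ?_) hlim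
    obtain ⟨j, rfl⟩ := Nat.exists_eq_add_of_le hnk
    rw [le_div_iff₀ hδ, mul_comm]
    have := hsmall n _ (hmem (n + 1) j)
    rwa [show n + 1 + j = n + j + 1 by ring] at this
  obtain ⟨a, ha⟩ := cauchySeq_tendsto_of_complete hcau
  have hclosed : ∀ y, IsClosed (S y) := fun y => by
    have : LowerSemicontinuous fun z => f z + δ * dist y z :=
      hf.add (by fun_prop : Continuous fun z => δ * dist y z).lowerSemicontinuous
    exact this.isClosed_preimage (f y)
  have haS : ∀ n, a ∈ S (x n) := by
    intro n
    refine (hclosed _).mem_of_tendsto ha ?_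
    filter_upwards [eventually_ge_atTop n] with k hk
    obtain ⟨j, rfl⟩ := Nat.exists_eq_add_of_le hk
    exact hmem n (j + 1)
  refine ⟨a, ?_, fun y => ?_⟩
  · have h : f a + δ * dist x₀ a ≤ f x₀ := haS 0
    have := mul_nonneg hδ.le (dist_nonneg (x := x₀) (y := a))
    linarith
  · by_contra! hy
    have hyS : y ∈ S a := hy.le
    have hy0 : Tendsto (fun n => x (n + 1)) atTop (𝓝 y) := by
      rw [tendsto_iff_dist_tendsto_zero]
      refine squeeze_zero (fun _ => dist_nonneg) (fun n => ?_) hlim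
      rw [le_div_iff₀ hδ, mul_comm]
      exact hsmall n y (htrans (haS (n + 1)) hyS)
    obtain rfl := tendsto_nhds_unique ha hy0
    simp at hy

/-! ### Real values of the functionals -/

section Values

variable {X : Type*} {Ψ : X → ℝ≥0∞} {Φ : X → ℝ}

/-- The value of `λ Ψ - Φ` as a real number; meaningful only where `Ψ` is finite. -/
noncomputable def action (Ψ : X → ℝ≥0∞) (Φ : X → ℝ) (lam : ℝ) (u : X) : ℝ :=
  lam * (Ψ u).toReal - Φ u

theorem energy_eq_action {lam : ℝ} {u : X} (hu : Ψ u < ∞) :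
    energy Ψ Φ lam u = (action Ψ Φ lam u : EReal) := by
  lift Ψ u to ℝ≥0 using hu.ne with r hr
  simp only [energy, action, ← hr, EReal.coe_nnreal_eq_coe_real, ENNReal.coe_toReal]
  norm_cast

theorem energy_eq_top {lam : ℝ} (hlam : 0 < lam) {u : X} (hu : Ψ u = ∞) :
    energy Ψ Φ lam u = ⊤ := by
  simp [energy, hu, EReal.coe_mul_top_of_pos hlam]

theorem energy_le_coe_iff {lam : ℝ} (hlam : 0 < lam) {u : X} {a : ℝ} :
    energy Ψ Φ lam u ≤ a ↔ Ψ u < ∞ ∧ action Ψ Φ lam u ≤ a := by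
  rcases eq_or_ne (Ψ u) ∞ with hu | hu
  · simp [energy_eq_top hlam hu, hu]
  · simp [energy_eq_action hu.lt_top, hu.lt_top]

theorem action_mono {lam mu : ℝ} (h : lam ≤ mu) (u : X) :
    action Ψ Φ lam u ≤ action Ψ Φ mu u := by
  have := mul_le_mul_of_nonneg_right h (ENNReal.toReal_nonneg (a := Ψ u))
  simp only [action]
  linarith

/-- The real-valued `Ψ` is lower semicontinuous along functions with values in its domain. -/
theorem eventually_lt_toReal [TopologicalSpace X] {ι : Type*} {l : Filter ι} {g : ι → X} {x : X}
    (hΨ : LowerSemicontinuous Ψ) (hg : Tendsto g l (𝓝 x)) (hfin : ∀ i, Ψ (g i) < ∞)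
    {y : ℝ} (hy : y < (Ψ x).toReal) : ∀ᶠ i in l, y < (Ψ (g i)).toReal := by
  rcases lt_or_ge y 0 with h0 | h0
  · exact Eventually.of_forall fun i => h0.trans_le ENNReal.toReal_nonneg
  · have hlt : ENNReal.ofReal y < Ψ x := by
      by_contra! h
      exact absurd (ENNReal.toReal_le_of_le_ofReal h0 h) (not_le.2 hy)
    filter_upwards [hg.eventually (hΨ x _ hlt)] with i hi
    exact (ENNReal.ofReal_lt_iff_lt_toReal h0 (hfin i).ne).1 hi

end Values

section Functional

variable {X : Type*} [NormedAddCommGroup X] [NormedSpace ℝ X] {Ψ : X → ℝ≥0∞} {Φ : X → ℝ}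

/-- The left-hand side `λ (Ψ v - Ψ u) - Φ'(u)(v - u)` of Szulkin's variational inequality as a
real number; meaningful only where `Ψ u` and `Ψ v` are finite. -/
noncomputable def defect (Ψ : X → ℝ≥0∞) (Φ : X → ℝ) (lam : ℝ) (u v : X) : ℝ :=
  lam * ((Ψ v).toReal - (Ψ u).toReal) - fderiv ℝ Φ u (v - u)

theorem isCriticalPoint_iff {lam : ℝ} (hlam : 0 < lam) {u : X} :
    IsCriticalPoint Ψ Φ lam u ↔
      Ψ u < ∞ ∧ ∀ v, Ψ v < ∞ → 0 ≤ defect Ψ Φ lam u v := by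
  have key : ∀ v, Ψ u < ∞ → Ψ v < ∞ → ((lam : EReal) * ((Ψ v : EReal) - (Ψ u : EReal))
      - ((fderiv ℝ Φ u (v - u) : ℝ) : EReal) = (defect Ψ Φ lam u v : EReal)) := by
    intro v hu hv
    unfold defect
    lift Ψ u to ℝ≥0 using hu.ne with r
    lift Ψ v to ℝ≥0 using hv.ne with q
    simp only [EReal.coe_nnreal_eq_coe_real, ENNReal.coe_toReal]
    norm_cast
  constructor
  · intro h
    have hu : Ψ u < ∞ := by
      by_contra hu
      rw [not_lt, top_le_iff] at hu
      have := h u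
      simp [hu, EReal.coe_mul_bot_of_pos hlam] at this
    refine ⟨hu, fun v hv => ?_⟩
    have := h v
    rw [key v hu hv] at this
    exact_mod_cast this
  · rintro ⟨hu, h⟩ v
    rcases eq_or_ne (Ψ v) ∞ with hv | hv
    · lift Ψ u to ℝ≥0 using hu.ne with r
      have : (⊤ : EReal) - ((r : ℝ≥0∞) : EReal) = ⊤ := by
        rw [EReal.coe_nnreal_eq_coe_real]; exact EReal.top_sub_coe _
      rw [hv, EReal.coe_ennreal_top, this, EReal.coe_mul_top_of_pos hlam, EReal.top_sub_coe]
      exact le_top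
    · rw [key v hu hv.lt_top]
      exact_mod_cast h v hv.lt_top

/-- Convexity of `Ψ` along a segment, for the real values of `Ψ` on its domain. -/
theorem toReal_segment_le (hΨ : ConvexOn ℝ≥0 univ Ψ) {u v : X} (hu : Ψ u < ∞) (hv : Ψ v < ∞)
    {a b : ℝ} (ha : 0 ≤ a) (hb : 0 ≤ b) (hab : a + b = 1) :
    Ψ (a • u + b • v) < ∞ ∧
      (Ψ (a • u + b • v)).toReal ≤ a * (Ψ u).toReal + b * (Ψ v).toReal := by
  lift a to ℝ≥0 using ha
  lift b to ℝ≥0 using hb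
  have h := hΨ.2 (mem_univ u) (mem_univ v) (zero_le (a := a)) (zero_le (a := b))
    (by exact_mod_cast hab)
  lift Ψ u to ℝ≥0 using hu.ne with r
  lift Ψ v to ℝ≥0 using hv.ne with q
  have h' : Ψ ((a : ℝ) • u + (b : ℝ) • v) ≤ ((a * r + b * q : ℝ≥0) : ℝ≥0∞) := by
    simpa [ENNReal.smul_def, NNReal.smul_def] using h
  refine ⟨h'.trans_lt ENNReal.coe_lt_top, ?_⟩
  have := ENNReal.toReal_mono ENNReal.coe_ne_top h'
  rw [ENNReal.coe_toReal] at this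
  simpa only [NNReal.coe_add, NNReal.coe_mul, ENNReal.coe_toReal] using this

/-- A convex lower semicontinuous function is weakly sequentially lower semicontinuous. -/
theorem le_of_weaklyConverges (hΨ : LowerSemicontinuous Ψ) (hΨ' : ConvexOn ℝ≥0 univ Ψ)
    {u : ℕ → X} {w : X} (hu : WeaklyConverges u w) {a : ℝ≥0∞} (ha : ∃ᶠ j in atTop, Ψ (u j) ≤ a) :
    Ψ w ≤ a := by
  have hconv : Convex ℝ (Ψ ⁻¹' Iic a) := by
    intro x hx y hy p q hp hq hpq
    lift p to ℝ≥0 using hp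
    lift q to ℝ≥0 using hq
    have hpq' : p + q = 1 := by exact_mod_cast hpq
    calc Ψ (p • x + q • y) ≤ p • Ψ x + q • Ψ y :=
          hΨ'.2 (mem_univ x) (mem_univ y) (zero_le (a := p)) (zero_le (a := q)) hpq'
      _ ≤ p • a + q • a := by gcongr <;> assumption
      _ = a := by rw [← add_smul, hpq', one_smul]
  have hcl := hconv.toWeakSpace_closure (𝕜 := ℝ)
  rw [(hΨ.isClosed_preimage a).closure_eq] at hcl
  have hmem : toWeakSpace ℝ X w ∈ closure (toWeakSpace ℝ X '' (Ψ ⁻¹' Iic a)) :=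
    mem_closure_of_frequently_of_tendsto (ha.mono fun j hj => mem_image_of_mem _ hj) hu
  rw [← hcl] at hmem
  obtain ⟨x, hx, hxw⟩ := hmem
  rwa [← (toWeakSpace ℝ X).injective hxw]

/-- The standing assumptions on `Ψ` and `Φ`: those of the mountain pass theorem except coercivity
of `Ψ`, boundedness of the critical sets and the mountain pass geometry. -/
structure StandingAssumptions (Ψ : X → ℝ≥0∞) (Φ : X → ℝ) : Prop where
  lsc : LowerSemicontinuous Ψ
  convex : ConvexOn ℝ≥0 univ Ψ
  zero : Ψ 0 = 0
  strong : ∀ (u : ℕ → X) (w : X), (∀ j, Ψ (u j) < ∞) → Ψ w < ∞ → WeaklyConverges u w →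
    Tendsto (fun j => Ψ (u j)) atTop (𝓝 (Ψ w)) → Tendsto (fun j => ‖u j - w‖) atTop (𝓝 0)
  contDiff : ContDiff ℝ 1 Φ
  liminf_fderiv : ∀ u : ℕ → X, Bornology.IsBounded (range u) →
    ∃ (φ : ℕ → ℕ) (w : X), StrictMono φ ∧ WeaklyConverges (u ∘ φ) w ∧
      ∀ v : X, ((fderiv ℝ Φ w (v - w) : ℝ) : EReal) ≤
        liminf (fun j => ((fderiv ℝ Φ (u (φ j)) (v - u (φ j)) : ℝ) : EReal)) atTop

theorem StandingAssumptions.continuous_fderiv (h : StandingAssumptions Ψ Φ) :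
    Continuous (fderiv ℝ Φ) :=
  h.contDiff.continuous_fderiv one_ne_zero

/-! ### Compactness of bounded almost critical sequences -/

/-- A bounded sequence that is asymptotically critical for `I_{λₙ}`, with `λₙ → λ > 0`, has a
subsequence converging in norm, and with convergence of `Ψ`, to a critical point of `I_λ`. -/
theorem StandingAssumptions.exists_subseq_tendsto (h : StandingAssumptions Ψ Φ) {u : ℕ → X}
    (hu : Bornology.IsBounded (range u)) (hfin : ∀ n, Ψ (u n) < ∞) {lam : ℕ → ℝ} {l : ℝ}
    (hl : 0 < l) (hlam : Tendsto lam atTop (𝓝 l))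
    (hcrit : ∀ v, Ψ v < ∞ → ∀ e > 0, ∀ᶠ n in atTop, -e ≤ defect Ψ Φ (lam n) (u n) v) :
    ∃ (φ : ℕ → ℕ) (w : X), StrictMono φ ∧ Tendsto (fun j => u (φ j)) atTop (𝓝 w) ∧
      Tendsto (fun j => (Ψ (u (φ j))).toReal) atTop (𝓝 (Ψ w).toReal) ∧
      IsCriticalPoint Ψ Φ l w := by
  obtain ⟨φ, w, hφ, hweak, hlim⟩ := h.liminf_fderiv u hu
  have hlow : ∀ v, ∀ y < fderiv ℝ Φ w (v - w),
      ∀ᶠ j in atTop, y < fderiv ℝ Φ (u (φ j)) (v - u (φ j)) := by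
    intro v y hy
    have := eventually_lt_of_lt_liminf ((EReal.coe_lt_coe_iff.2 hy).trans_le (hlim v))
    exact this.mono fun j hj => EReal.coe_lt_coe_iff.1 hj
  have hcrit' : ∀ v, Ψ v < ∞ → ∀ e > 0, ∀ᶠ j in atTop,
      -e ≤ defect Ψ Φ (lam (φ j)) (u (φ j)) v :=
    fun v hv e he => hφ.tendsto_atTop.eventually (hcrit v hv e he)
  have hlam' : Tendsto (fun j => lam (φ j)) atTop (𝓝 l) := hlam.comp hφ.tendsto_atTop
  have hhalf : ∀ᶠ j in atTop, l / 2 < lam (φ j) := hlam'.eventually (lt_mem_nhds (half_lt_self hl))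
  -- testing with `v = 0` bounds `Ψ` along the subsequence
  obtain ⟨K, hK⟩ : ∃ K, ∀ᶠ j in atTop, (Ψ (u (φ j))).toReal ≤ K := by
    refine ⟨(2 - fderiv ℝ Φ w (0 - w)) / (l / 2), ?_⟩
    filter_upwards [hlow 0 _ (sub_one_lt _), hcrit' 0 (by simp [h.zero]) 1 one_pos, hhalf]
      with j h1 h2 h3
    rw [le_div_iff₀ (half_pos hl)]
    simp only [defect, h.zero, ENNReal.toReal_zero] at h2
    have := mul_le_mul_of_nonneg_left h3.le (ENNReal.toReal_nonneg (a := Ψ (u (φ j))))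
    linarith
  have hle : ∀ {K}, (∃ᶠ j in atTop, (Ψ (u (φ j))).toReal ≤ K) → Ψ w ≤ ENNReal.ofReal K :=
    fun hK => le_of_weaklyConverges h.lsc h.convex hweak
      (hK.mono fun j hj => ENNReal.le_ofReal_iff_toReal_le (hfin _).ne
        (ENNReal.toReal_nonneg.trans hj) |>.2 hj)
  have hw : Ψ w < ∞ := (hle hK.frequently).trans_lt ENNReal.ofReal_lt_top
  have hΨ : Tendsto (fun j => (Ψ (u (φ j))).toReal) atTop (𝓝 (Ψ w).toReal) := by
    rw [tendsto_order]
    refine ⟨fun y hy => ?_, fun y hy => ?_⟩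
    · by_contra hcon
      have hfr : ∃ᶠ j in atTop, (Ψ (u (φ j))).toReal ≤ y := by
        simpa only [not_eventually, not_lt] using hcon
      obtain ⟨j, hj⟩ := hfr.exists
      have := ENNReal.toReal_le_of_le_ofReal (ENNReal.toReal_nonneg.trans hj) (hle hfr)
      exact absurd hy (not_lt.2 this)
    -- testing with `v = w` gives the upper bound for `Ψ`
    · set e := (y - (Ψ w).toReal) * l / 4 with he
      have hepos : 0 < e := by have := sub_pos.2 hy; positivity
      filter_upwards [hlow w (-(e / 2)) (by simp [hepos]), hcrit' w hw (e / 2) (half_pos hepos),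
        hhalf] with j h1 h2 h3
      simp only [defect] at h2
      by_contra! h4
      have h5 : l / 2 * (y - (Ψ w).toReal) ≤
          lam (φ j) * ((Ψ (u (φ j))).toReal - (Ψ w).toReal) := by
        gcongr
        linarith [half_pos hl]
      nlinarith
  have hnorm : Tendsto (fun j => u (φ j)) atTop (𝓝 w) := by
    rw [tendsto_iff_norm_sub_tendsto_zero]
    exact h.strong _ w (fun j => hfin _) hw hweak
      ((ENNReal.tendsto_toReal_iff (fun j => (hfin _).ne) hw.ne).1 hΨ)
  refine ⟨φ, w, hφ, hnorm, hΨ, (isCriticalPoint_iff hl).2 ⟨hw, fun v hv => ?_⟩⟩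
  have hD : Tendsto (fun j => defect Ψ Φ (lam (φ j)) (u (φ j)) v) atTop
      (𝓝 (defect Ψ Φ l w v)) := by
    refine (hlam'.mul (tendsto_const_nhds.sub hΨ)).sub ?_
    have hcont : Continuous fun x => fderiv ℝ Φ x (v - x) :=
      h.continuous_fderiv.clm_apply (continuous_const.sub continuous_id)
    exact (hcont.tendsto w).comp hnorm
  refine le_of_forall_pos_le_add fun e he => ?_
  have := ge_of_tendsto hD (hcrit' v hv e he)
  linarith

/-! ### Deformation of a path -/

theorem defect_segment_le (hΨ : ConvexOn ℝ≥0 univ Ψ) {lam : ℝ} (hlam : 0 ≤ lam) {u v w : X}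
    (hv : Ψ v < ∞) (hw : Ψ w < ∞) {a b : ℝ} (ha : 0 ≤ a) (hb : 0 ≤ b) (hab : a + b = 1) :
    defect Ψ Φ lam u (a • v + b • w) ≤ a * defect Ψ Φ lam u v + b * defect Ψ Φ lam u w := by
  have h1 := mul_le_mul_of_nonneg_left (toReal_segment_le hΨ hv hw ha hb hab).2 hlam
  have h2 : a • v + b • w - u = a • (v - u) + b • (w - u) := by
    rw [show a • (v - u) + b • (w - u) = a • v + b • w - (a + b) • u by module, hab, one_smul]
  obtain rfl : b = 1 - a := by linarith
  simp only [defect, h2, map_add, map_smul, smul_eq_mul]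
  linarith

theorem convex_defect_lt (hΨ : ConvexOn ℝ≥0 univ Ψ) {lam : ℝ} (hlam : 0 ≤ lam) (u : X) (c : ℝ) :
    Convex ℝ {v | Ψ v < ∞ ∧ defect Ψ Φ lam u v < c} := by
  rintro v ⟨hv, hv'⟩ w ⟨hw, hw'⟩ a b ha hb hab
  refine ⟨(toReal_segment_le hΨ hv hw ha hb hab).1,
    (defect_segment_le hΨ hlam hv hw ha hb hab).trans_lt ?_⟩
  have := (convex_Iio c) hv' hw' ha hb hab
  simpa using this

/-- The defect is upper semicontinuous in its base point. -/
theorem StandingAssumptions.eventually_defect_lt (h : StandingAssumptions Ψ Φ) {lam : ℝ}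
    (hlam : 0 < lam) {ι : Type*} [TopologicalSpace ι] {γ : ι → X} (hγ : Continuous γ)
    (hfin : ∀ t, Ψ (γ t) < ∞) {t₀ : ι} {v : X} {c : ℝ} (hc : defect Ψ Φ lam (γ t₀) v < c) :
    ∀ᶠ t in 𝓝 t₀, defect Ψ Φ lam (γ t) v < c := by
  set g := c - defect Ψ Φ lam (γ t₀) v with hg
  have hgpos : 0 < g := sub_pos.2 hc
  have h1 : ∀ᶠ t in 𝓝 t₀, (Ψ (γ t₀)).toReal - g / (2 * lam) < (Ψ (γ t)).toReal :=
    eventually_lt_toReal h.lsc hγ.continuousAt hfin (sub_lt_self _ (by positivity))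
  have hcont : Continuous fun t => fderiv ℝ Φ (γ t) (v - γ t) :=
    (h.continuous_fderiv.comp hγ).clm_apply (continuous_const.sub hγ)
  have h2 := (hcont.tendsto t₀).eventually (lt_mem_nhds (sub_lt_self _ (half_pos hgpos)))
  filter_upwards [h1, h2] with t h1 h2
  have h3 := mul_lt_mul_of_pos_left h1 hlam
  have h4 : lam * (g / (2 * lam)) = g / 2 := by field_simp
  simp only [defect] at hg ⊢
  linarith

/-- First-order expansion of a `C¹` function along a segment, uniformly over a compact family of
segments. -/
theorem exists_uniform_taylor (hΦ : ContDiff ℝ 1 Φ) {ι : Type*} [TopologicalSpace ι]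
    [CompactSpace ι] {γ d : ι → X} (hγ : Continuous γ) (hd : Continuous d) {e : ℝ} (he : 0 < e) :
    ∃ s₀ > 0, ∀ s, 0 ≤ s → s < s₀ → ∀ t,
      |Φ (γ t + s • d t) - Φ (γ t) - s * fderiv ℝ Φ (γ t) (d t)| ≤ e * s := by
  have hΦ' : Continuous (fderiv ℝ Φ) := hΦ.continuous_fderiv one_ne_zero
  have hcont : Continuous fun z : ℝ × ι =>
      ‖(fderiv ℝ Φ (γ z.2 + z.1 • d z.2) - fderiv ℝ Φ (γ z.2)) (d z.2)‖ := by
    have h1 : Continuous fun z : ℝ × ι => γ z.2 + z.1 • d z.2 := by fun_prop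
    exact (((hΦ'.comp h1).sub (hΦ'.comp (hγ.comp continuous_snd))).clm_apply
      (hd.comp continuous_snd)).norm
  have hev : ∀ᶠ s in 𝓝 (0 : ℝ), ∀ t ∈ (univ : Set ι),
      ‖(fderiv ℝ Φ (γ t + s • d t) - fderiv ℝ Φ (γ t)) (d t)‖ < e :=
    isCompact_univ.eventually_forall_of_forall_eventually fun t _ =>
      (hcont.tendsto (0, t)).eventually (gt_mem_nhds (by simpa using he))
  obtain ⟨s₀, hs₀, hball⟩ := Metric.eventually_nhds_iff.1 hev
  refine ⟨s₀, hs₀, fun s hs hss t => ?_⟩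
  have hderiv : ∀ σ ∈ Icc 0 s, HasDerivWithinAt
      (fun σ : ℝ => Φ (γ t + σ • d t) - σ * fderiv ℝ Φ (γ t) (d t))
      ((fderiv ℝ Φ (γ t + σ • d t) - fderiv ℝ Φ (γ t)) (d t)) (Icc 0 s) σ := by
    intro σ _
    have h1 : HasDerivAt (fun σ : ℝ => γ t + σ • d t) (d t) σ := by
      simpa using ((hasDerivAt_id σ).smul_const (d t)).const_add (γ t)
    have h2 := ((hΦ.differentiable one_ne_zero (γ t + σ • d t)).hasFDerivAt.comp_hasDerivAt σ h1)
    have h3 := (hasDerivAt_id σ).mul_const (fderiv ℝ Φ (γ t) (d t))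
    have h4 := h2.sub h3
    rw [one_mul] at h4
    exact h4.hasDerivWithinAt
  have := (convex_Icc (0 : ℝ) s).norm_image_sub_le_of_norm_hasDerivWithin_le hderiv
    (fun σ hσ => (hball (by rw [Real.dist_eq, sub_zero, abs_of_nonneg hσ.1]; exact hσ.2.trans_lt hss)
      t (mem_univ t)).le) (left_mem_Icc.2 hs) (right_mem_Icc.2 hs)
  simp only [zero_smul, add_zero, zero_mul, sub_zero, Real.norm_eq_abs, abs_of_nonneg hs] at this
  rwa [show Φ (γ t + s • d t) - Φ (γ t) - s * fderiv ℝ Φ (γ t) (d t) =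
    Φ (γ t + s • d t) - s * fderiv ℝ Φ (γ t) (d t) - Φ (γ t) by ring]

/-- If at every point of a path where `I_λ` is close to its bound `A` there is a direction of
descent for `I_λ` that hardly increases `I_μ`, then the whole path can be moved, with fixed
endpoints, so that the bound for `I_λ` drops at a rate exceeding the growth of the one for
`I_μ`. -/
theorem StandingAssumptions.exists_deformation (h : StandingAssumptions Ψ Φ) {lam mu : ℝ}
    (hlam : 0 < lam) (hmu : 0 < mu) {γ : C(unitInterval, X)} (hfin : ∀ t, Ψ (γ t) < ∞)
    {A B η R : ℝ} (hη : 0 < η) (hR : 0 < R) (hA : ∀ t, action Ψ Φ lam (γ t) ≤ A)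
    (hB : ∀ t, action Ψ Φ mu (γ t) ≤ B) (h0 : action Ψ Φ lam (γ 0) ≤ A - 4 * η)
    (h1 : action Ψ Φ lam (γ 1) ≤ A - 4 * η)
    (hdesc : ∀ t, A - 4 * η < action Ψ Φ lam (γ t) → ∃ v, Ψ v < ∞ ∧ ‖v - γ t‖ < R ∧
      defect Ψ Φ lam (γ t) v < -η ∧ defect Ψ Φ mu (γ t) v < η / 4) :
    ∃ s₀ > 0, ∀ s, 0 < s → s < s₀ → ∃ γ' : C(unitInterval, X), γ' 0 = γ 0 ∧ γ' 1 = γ 1 ∧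
      dist γ γ' ≤ s * R ∧ ∀ t, Ψ (γ' t) < ∞ ∧
        action Ψ Φ lam (γ' t) ≤ A - s * (3 / 4 * η) ∧
        action Ψ Φ mu (γ' t) ≤ B + s * (1 / 2 * η) := by
  -- `C t` holds the admissible targets for `γ t`: neither functional increases much towards them,
  -- `I_λ` decreases where it is high, and the endpoints stay fixed.
  let C : unitInterval → Set X := fun t =>
    ({v | Ψ v < ∞ ∧ defect Ψ Φ lam (γ t) v < η / 4} ∩
      {v | Ψ v < ∞ ∧ defect Ψ Φ mu (γ t) v < η / 4}) ∩ Metric.ball (γ t) R ∩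
    {v | A - 2 * η < action Ψ Φ lam (γ t) → v ∈ {v | Ψ v < ∞ ∧ defect Ψ Φ lam (γ t) v < -η}} ∩
    ({v | t = 0 → v = γ 0} ∩ {v | t = 1 → v = γ 1})
  have himp : ∀ {p : Prop} {S : Set X}, Convex ℝ S → Convex ℝ {v | p → v ∈ S} := by
    intro p S hS
    by_cases hp : p
    · simpa [hp] using hS
    · simpa [hp] using (convex_univ : Convex ℝ (univ : Set X))
  have hC : ∀ t, Convex ℝ (C t) := fun t =>
    (((convex_defect_lt h.convex hlam.le _ _).inter (convex_defect_lt h.convex hmu.le _ _)).inter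
      (convex_ball _ _) |>.inter (himp (convex_defect_lt h.convex hlam.le _ _))).inter
      ((himp (convex_singleton (γ 0))).inter (himp (convex_singleton (γ 1))))
  have hloc : ∀ t₀, ∃ v, ∀ᶠ t in 𝓝 t₀, v ∈ C t := by
    intro t₀
    have hball : ∀ v, ‖v - γ t₀‖ < R → ∀ᶠ t in 𝓝 t₀, v ∈ Metric.ball (γ t) R := by
      intro v hv
      have : Continuous fun t => ‖v - γ t‖ := by fun_prop
      filter_upwards [(this.tendsto t₀).eventually (gt_mem_nhds hv)] with t ht
      rwa [Metric.mem_ball, dist_eq_norm]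
    rcases le_or_gt (action Ψ Φ lam (γ t₀)) (A - 4 * η) with hlow | hhigh
    -- a low point attracts the points of the path near it
    · refine ⟨γ t₀, ?_⟩
      have hself : ∀ ν : ℝ, defect Ψ Φ ν (γ t₀) (γ t₀) < η / 4 := fun ν => by
        simp [defect, hη]
      have hrem : Continuous fun t =>
          Φ (γ t₀) - Φ (γ t) - fderiv ℝ Φ (γ t) (γ t₀ - γ t) :=
        (continuous_const.sub (h.contDiff.continuous.comp γ.continuous)).sub
          ((h.continuous_fderiv.comp γ.continuous).clm_apply (continuous_const.sub γ.continuous))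
      have hsep : ∀ a : unitInterval, ∀ᶠ t in 𝓝 t₀, t = a → γ t₀ = γ a := by
        intro a
        by_cases ha : t₀ = a
        · exact Eventually.of_forall fun t _ => by rw [ha]
        · exact (eventually_ne_nhds ha).mono fun t ht hta => absurd hta ht
      filter_upwards [h.eventually_defect_lt hlam γ.continuous hfin (hself lam),
        h.eventually_defect_lt hmu γ.continuous hfin (hself mu), hball (γ t₀) (by simpa using hR),
        (hrem.tendsto t₀).eventually (gt_mem_nhds
          (show _ < η by simpa using hη)), hsep 0, hsep 1]
        with t e1 e2 e3 e4 e5 e6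
      refine ⟨⟨⟨⟨⟨hfin _, e1⟩, hfin _, e2⟩, e3⟩, fun hhigh => ⟨hfin _, ?_⟩⟩, e5, e6⟩
      simp only [action, defect] at hlow hhigh ⊢
      linarith
    -- a high point is not an endpoint, and its direction of descent serves its neighbours as well
    · obtain ⟨v, hv, hvR, hvl, hvm⟩ := hdesc t₀ hhigh
      have hne0 : t₀ ≠ 0 := by rintro rfl; linarith
      have hne1 : t₀ ≠ 1 := by rintro rfl; linarith
      refine ⟨v, ?_⟩
      filter_upwards [h.eventually_defect_lt hlam γ.continuous hfin hvl,
        h.eventually_defect_lt hmu γ.continuous hfin hvm, hball _ hvR,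
        eventually_ne_nhds hne0, eventually_ne_nhds hne1] with t e1 e2 e3 e4 e5
      exact ⟨⟨⟨⟨⟨hv, e1.trans (by linarith)⟩, hv, e2⟩, e3⟩, fun _ => ⟨hv, e1⟩⟩,
        fun ht => absurd ht e4, fun ht => absurd ht e5⟩
  obtain ⟨g, hg⟩ := exists_continuous_forall_mem_convex_of_local_const hC hloc
  obtain ⟨s₀, hs₀, htaylor⟩ := exists_uniform_taylor h.contDiff γ.continuous
    (g.continuous.sub γ.continuous) (show 0 < η / 4 by positivity)
  refine ⟨min s₀ 1, lt_min hs₀ one_pos, fun s hs hss => ?_⟩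
  have hs1 : s < 1 := hss.trans_le (min_le_right _ _)
  have hconv : ∀ t, γ t + s • (g t - γ t) = (1 - s) • γ t + s • g t := fun t => by module
  have key : ∀ {ν : ℝ}, 0 < ν → ∀ t, action Ψ Φ ν (γ t + s • (g t - γ t)) ≤
      action Ψ Φ ν (γ t) + s * defect Ψ Φ ν (γ t) (g t) + s * (η / 4) := by
    intro ν hν t
    have h2 := (abs_le.1 (htaylor s hs.le (hss.trans_le (min_le_left _ _)) t)).1
    have h3 := mul_le_mul_of_nonneg_left (toReal_segment_le h.convex (hfin t) (hg t).1.1.1.1.1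
      (sub_nonneg.2 hs1.le) hs.le (sub_add_cancel 1 s)).2 hν.le
    rw [← hconv] at h3
    simp only [action, defect, Pi.sub_apply] at h2 ⊢
    linarith
  refine ⟨⟨fun t => γ t + s • (g t - γ t), by fun_prop⟩, ?_, ?_, ?_, fun t => ⟨?_, ?_, ?_⟩⟩
  · simp [(hg 0).2.1 rfl]
  · simp [(hg 1).2.2 rfl]
  · rw [ContinuousMap.dist_le (by positivity)]
    intro t
    have := (hg t).1.1.2
    rw [Metric.mem_ball, dist_eq_norm] at this
    simp only [ContinuousMap.coe_mk, dist_self_add_right, norm_smul, Real.norm_eq_abs, abs_of_pos hs]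
    gcongr
  · change Ψ (γ t + s • (g t - γ t)) < ∞
    rw [hconv]
    exact (toReal_segment_le h.convex (hfin t) (hg t).1.1.1.1.1
      (sub_nonneg.2 hs1.le) hs.le (sub_add_cancel 1 s)).1
  · refine (key hlam t).trans ?_
    rcases le_or_gt (action Ψ Φ lam (γ t)) (A - 2 * η) with hlow | hhigh
    · have h2 := mul_le_mul_of_nonneg_left (hg t).1.1.1.1.2.le hs.le
      have h3 := mul_lt_mul_of_pos_right hs1 hη
      linarith
    · have h2 := mul_le_mul_of_nonneg_left ((hg t).1.2 hhigh).2.le hs.le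
      linarith [hA t]
  · refine (key hmu t).trans ?_
    have h2 := mul_le_mul_of_nonneg_left (hg t).1.1.1.2.2.le hs.le
    linarith [hB t]

end Functional

section Topological

variable {X : Type*} [NormedAddCommGroup X] {Ψ : X → ℝ≥0∞} {Φ : X → ℝ}

/-! ### Sublevel sets of the action and its supremum along paths -/

theorem isClosed_action_le (hΨ : LowerSemicontinuous Ψ) (hΦ : Continuous Φ) {mu : ℝ}
    (hmu : 0 < mu) (K : ℝ) : IsClosed {u | Ψ u < ∞ ∧ action Ψ Φ mu u ≤ K} := by
  have heq : {u | Ψ u < ∞ ∧ action Ψ Φ mu u ≤ K} =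
      {u | Ψ u ≤ ENNReal.ofReal ((K + Φ u) / mu)} ∩ {u | 0 ≤ (K + Φ u) / mu} := by
    ext u
    have hiff : action Ψ Φ mu u ≤ K ↔ (Ψ u).toReal ≤ (K + Φ u) / mu := by
      rw [le_div_iff₀ hmu, action, mul_comm]
      constructor <;> intro <;> linarith
    constructor
    · rintro ⟨h1, h2⟩
      have h3 := hiff.1 h2
      have h4 := ENNReal.toReal_nonneg.trans h3
      exact ⟨(ENNReal.le_ofReal_iff_toReal_le h1.ne h4).2 h3, h4⟩
    · rintro ⟨h1, h2⟩
      have h3 : Ψ u < ∞ := lt_of_le_of_lt h1 ENNReal.ofReal_lt_top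
      exact ⟨h3, hiff.2 ((ENNReal.le_ofReal_iff_toReal_le h3.ne h2).1 h1)⟩
  rw [heq]
  have hc : Continuous fun u => (K + Φ u) / mu := by fun_prop
  have hc' : Continuous fun u => (u, ENNReal.ofReal ((K + Φ u) / mu)) :=
    continuous_id.prodMk (ENNReal.continuous_ofReal.comp hc)
  exact (hΨ.isClosed_epigraph.preimage hc').inter (isClosed_le continuous_const hc)

/-- The supremum of `I_λ` along a path is a lower semicontinuous function of the path. -/
theorem lowerSemicontinuous_iSup_action (hΨ : LowerSemicontinuous Ψ) (hΦ : Continuous Φ)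
    {P : Set C(unitInterval, X)} (hfin : ∀ γ ∈ P, ∀ t, Ψ (γ t) < ∞) {lam : ℝ} (hlam : 0 < lam)
    (hbdd : ∀ γ ∈ P, BddAbove (range fun t => action Ψ Φ lam (γ t))) :
    LowerSemicontinuous fun γ : P => ⨆ t, action Ψ Φ lam (γ.1 t) := by
  intro γ y hy
  obtain ⟨t, ht⟩ := exists_lt_of_lt_ciSup hy
  have hev : Continuous fun γ : P => γ.1 t := by fun_prop
  set g := action Ψ Φ lam (γ.1 t) - y with hg
  have hgpos : 0 < g := sub_pos.2 ht
  have h1 := eventually_lt_toReal (l := 𝓝 γ) hΨ hev.continuousAt (fun γ => hfin γ.1 γ.2 t)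
    (sub_lt_self _ (show 0 < g / (2 * lam) by positivity))
  have h2 := ((hΦ.comp hev).tendsto γ).eventually (gt_mem_nhds (lt_add_of_pos_right _ (half_pos hgpos)))
  filter_upwards [h1, h2] with γ' h1 h2
  refine lt_of_lt_of_le ?_ (le_ciSup (hbdd γ'.1 γ'.2) t)
  have h3 := mul_lt_mul_of_pos_left h1 hlam
  have h4 : lam * (g / (2 * lam)) = g / 2 := by field_simp
  simp only [action, Function.comp_apply] at hg h2 ⊢
  linarith

/-! ### The mountain pass level -/

/-- The real numbers bounding `I_λ` from above along some path from `0` to `u₀`. -/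
def pathBounds (Ψ : X → ℝ≥0∞) (Φ : X → ℝ) (u₀ : X) (lam : ℝ) : Set ℝ :=
  {a | ∃ γ : C(unitInterval, X), γ 0 = 0 ∧ γ 1 = u₀ ∧
    ∀ t, Ψ (γ t) < ∞ ∧ action Ψ Φ lam (γ t) ≤ a}

/-- The mountain pass level as a real number. -/
noncomputable def level (Ψ : X → ℝ≥0∞) (Φ : X → ℝ) (u₀ : X) (lam : ℝ) : ℝ :=
  sInf (pathBounds Ψ Φ u₀ lam)

theorem pathBounds_anti {u₀ : X} {lam mu : ℝ} (h : lam ≤ mu) :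
    pathBounds Ψ Φ u₀ mu ⊆ pathBounds Ψ Φ u₀ lam := by
  rintro a ⟨γ, h0, h1, hγ⟩
  exact ⟨γ, h0, h1, fun t => ⟨(hγ t).1, (action_mono h _).trans (hγ t).2⟩⟩

theorem UniformMountainPassGeometry.endpoint_finite {ρ₀ α₀ ε : ℝ} {u₀ : X}
    (hMP : UniformMountainPassGeometry Ψ Φ ρ₀ α₀ ε u₀) : Ψ u₀ < ∞ := by
  have h := (le_max_right _ _).trans hMP.endpoints
  rw [← EReal.coe_zero, energy_le_coe_iff (by linarith [hMP.eps_pos])] at h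
  exact h.1

theorem UniformMountainPassGeometry.action_endpoints_nonpos {ρ₀ α₀ ε : ℝ} {u₀ : X}
    (hMP : UniformMountainPassGeometry Ψ Φ ρ₀ α₀ ε u₀) {lam : ℝ} (hlam : lam ≤ 1 + ε) :
    action Ψ Φ lam 0 ≤ 0 ∧ action Ψ Φ lam u₀ ≤ 0 := by
  have h := hMP.endpoints
  have hpos : 0 < 1 + ε := by linarith [hMP.eps_pos]
  rw [max_le_iff, ← EReal.coe_zero, energy_le_coe_iff hpos, energy_le_coe_iff hpos] at h
  exact ⟨(action_mono hlam _).trans h.1.2, (action_mono hlam _).trans h.2.2⟩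

/-- Every path from `0` to `u₀` crosses the sphere of radius `ρ₀`. -/
theorem UniformMountainPassGeometry.le_of_mem_pathBounds {ρ₀ α₀ ε : ℝ} {u₀ : X}
    (hMP : UniformMountainPassGeometry Ψ Φ ρ₀ α₀ ε u₀) {lam a : ℝ} (hlam : 1 - ε ≤ lam)
    (ha : a ∈ pathBounds Ψ Φ u₀ lam) : α₀ ≤ a := by
  obtain ⟨γ, h0, h1, hγ⟩ := ha
  obtain ⟨t, ht⟩ : ρ₀ ∈ range fun t => ‖γ t‖ := by
    refine mem_range_of_exists_le_of_exists_ge (by fun_prop) ⟨0, ?_⟩ ⟨1, ?_⟩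
    · simpa [h0] using hMP.radius_pos.le
    · simpa [h1] using hMP.radius_lt_norm.le
  have h2 : (α₀ : EReal) ≤ energy Ψ Φ (1 - ε) (γ t) := by
    rw [← hMP.iInf_sphere]
    exact iInf₂_le (γ t) (by simpa using ht)
  rw [energy_eq_action (hγ t).1, EReal.coe_le_coe_iff] at h2
  exact h2.trans ((action_mono hlam _).trans (hγ t).2)

theorem UniformMountainPassGeometry.bddBelow_pathBounds {ρ₀ α₀ ε : ℝ} {u₀ : X}
    (hMP : UniformMountainPassGeometry Ψ Φ ρ₀ α₀ ε u₀) {lam : ℝ} (hlam : 1 - ε ≤ lam) :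
    BddBelow (pathBounds Ψ Φ u₀ lam) :=
  ⟨α₀, fun _ ha => hMP.le_of_mem_pathBounds hlam ha⟩

end Topological

section Level

variable {X : Type*} [NormedAddCommGroup X] [NormedSpace ℝ X] {Ψ : X → ℝ≥0∞} {Φ : X → ℝ}

/-- The segment from `0` to `u₀` is a path of finite energy. -/
theorem StandingAssumptions.pathBounds_nonempty (h : StandingAssumptions Ψ Φ) {u₀ : X}
    (hu₀ : Ψ u₀ < ∞) {lam : ℝ} (hlam : 0 ≤ lam) : (pathBounds Ψ Φ u₀ lam).Nonempty := by
  let γ : C(unitInterval, X) := ⟨fun t => (t : ℝ) • u₀, by fun_prop⟩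
  have hcont : Continuous fun t => -Φ (γ t) := (h.contDiff.continuous.comp γ.continuous).neg
  obtain ⟨M, hM⟩ := (isCompact_range hcont).bddAbove
  refine ⟨lam * (Ψ u₀).toReal + M, γ, by simp [γ], by simp [γ], fun t => ?_⟩
  have hseg := toReal_segment_le h.convex (u := 0) (v := u₀) (by simp [h.zero]) hu₀
    (sub_nonneg.2 t.2.2) t.2.1 (sub_add_cancel 1 (t : ℝ))
  rw [smul_zero, zero_add, h.zero, ENNReal.toReal_zero, mul_zero, zero_add] at hseg
  refine ⟨hseg.1, ?_⟩
  have h1 : -Φ (γ t) ≤ M := hM (mem_range_self t)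
  have h2 : (Ψ (γ t)).toReal ≤ (Ψ u₀).toReal :=
    hseg.2.trans (mul_le_of_le_one_left ENNReal.toReal_nonneg t.2.2)
  have h3 := mul_le_mul_of_nonneg_left h2 hlam
  simp only [action]
  linarith

theorem StandingAssumptions.level_mono (h : StandingAssumptions Ψ Φ) {ρ₀ α₀ ε : ℝ} {u₀ : X}
    (hMP : UniformMountainPassGeometry Ψ Φ ρ₀ α₀ ε u₀) {lam mu : ℝ} (hlam : 1 - ε ≤ lam)
    (hle : lam ≤ mu) : level Ψ Φ u₀ lam ≤ level Ψ Φ u₀ mu :=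
  csInf_le_csInf (hMP.bddBelow_pathBounds hlam)
    (h.pathBounds_nonempty hMP.endpoint_finite (by linarith [hMP.eps_lt_one]))
    (pathBounds_anti hle)

theorem StandingAssumptions.mountainPassLevel_eq (h : StandingAssumptions Ψ Φ) {ρ₀ α₀ ε : ℝ}
    {u₀ : X} (hMP : UniformMountainPassGeometry Ψ Φ ρ₀ α₀ ε u₀) :
    mountainPassLevel Ψ Φ u₀ 1 = (level Ψ Φ u₀ 1 : EReal) := by
  have hε : 1 - ε ≤ 1 := by linarith [hMP.eps_pos]
  refine le_antisymm ?_ (le_iInf fun γ => ?_)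
  · refine EReal.le_of_forall_lt_iff_le.1 fun z hz => ?_
    obtain ⟨a, ⟨γ, h0, h1, hγ⟩, haz⟩ := exists_lt_of_csInf_lt
      (h.pathBounds_nonempty hMP.endpoint_finite zero_le_one) (EReal.coe_lt_coe_iff.1 hz)
    refine (iInf_le _ ⟨γ, h0, h1⟩).trans (iSup_le fun t => ?_)
    exact (energy_le_coe_iff one_pos).2 ⟨(hγ t).1, (hγ t).2.trans haz.le⟩
  · refine EReal.le_of_forall_lt_iff_le.1 fun z hz => ?_
    refine EReal.coe_le_coe_iff.2 (csInf_le (hMP.bddBelow_pathBounds hε)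
      ⟨γ.toContinuousMap, γ.source, γ.target, fun t => ?_⟩)
    exact (energy_le_coe_iff one_pos).1 ((le_iSup (fun t => energy Ψ Φ 1 (γ t)) t).trans hz.le)

/-- Right-continuity of the level at `1`: since `Ψ` is bounded along a path of finite energy, the
bound for `I_λ` along it tends to the one for `I_1`. -/
theorem StandingAssumptions.tendsto_level (h : StandingAssumptions Ψ Φ) {ρ₀ α₀ ε : ℝ} {u₀ : X}
    (hMP : UniformMountainPassGeometry Ψ Φ ρ₀ α₀ ε u₀) {lam : ℕ → ℝ} (hlam : ∀ n, 1 ≤ lam n)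
    (hlim : Tendsto lam atTop (𝓝 1)) :
    Tendsto (fun n => level Ψ Φ u₀ (lam n)) atTop (𝓝 (level Ψ Φ u₀ 1)) := by
  have hε := hMP.eps_pos
  rw [tendsto_order]
  refine ⟨fun y hy => Eventually.of_forall fun n =>
    hy.trans_le (h.level_mono hMP (by linarith) (hlam n)), fun y hy => ?_⟩
  obtain ⟨a, ⟨γ, h0, h1, hγ⟩, hay⟩ := exists_lt_of_csInf_lt
    (h.pathBounds_nonempty hMP.endpoint_finite zero_le_one) hy
  obtain ⟨M, hM⟩ := (isCompact_range (h.contDiff.continuous.comp γ.continuous)).bddAbove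
  have hcont : Tendsto (fun n => a + (lam n - 1) * (a + M)) atTop (𝓝 a) := by
    simpa using ((hlim.sub_const 1).mul_const (a + M)).const_add a
  filter_upwards [hcont.eventually (gt_mem_nhds hay)] with n hn
  refine (csInf_le (hMP.bddBelow_pathBounds (by linarith [hlam n]))
    ⟨γ, h0, h1, fun t => ⟨(hγ t).1, ?_⟩⟩).trans_lt hn
  have h2 : Φ (γ t) ≤ M := hM (mem_range_self t)
  have h3 := (hγ t).2
  simp only [action, one_mul] at h3 ⊢
  have h4 := mul_le_mul_of_nonneg_left (show (Ψ (γ t)).toReal ≤ a + M by linarith)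
    (sub_nonneg.2 (hlam n))
  linarith

/-! ### Almost critical points -/

/-- Ekeland's principle applied to `γ ↦ sup I_λ ∘ γ + sup I_μ ∘ γ`. Both terms are at least the
corresponding levels, so that a near-minimizer controls each of them from above. -/
theorem StandingAssumptions.exists_almost_critical [CompleteSpace X]
    (h : StandingAssumptions Ψ Φ) {ρ₀ α₀ ε : ℝ} {u₀ : X}
    (hMP : UniformMountainPassGeometry Ψ Φ ρ₀ α₀ ε u₀) {lam mu : ℝ} (hlam : 1 - ε ≤ lam)
    (hlm : lam ≤ mu) (hmu : mu ≤ 1 + ε) {η R b : ℝ} (hη : 0 < η) (hηα : 4 * η ≤ α₀) (hR : 0 < R)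
    (hb : level Ψ Φ u₀ mu < b) :
    ∃ u, Ψ u < ∞ ∧ level Ψ Φ u₀ lam - 4 * η ≤ action Ψ Φ lam u ∧
      action Ψ Φ lam u ≤ 2 * b - level Ψ Φ u₀ mu ∧
      action Ψ Φ mu u ≤ 2 * b - level Ψ Φ u₀ lam ∧
      ∀ v, Ψ v < ∞ → ‖v - u‖ < R →
        -η ≤ defect Ψ Φ lam u v ∨ η / 4 ≤ defect Ψ Φ mu u v := by
  have hlam0 : 0 < lam := by linarith [hMP.eps_lt_one]
  have hmu0 : 0 < mu := hlam0.trans_le hlm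
  have hα := hMP.height_pos
  -- the slack `1` lets small deformations of the Ekeland path stay admissible
  let P : Set C(unitInterval, X) := {γ | γ 0 = 0 ∧ γ 1 = u₀ ∧
    ∀ t, γ t ∈ {u | Ψ u < ∞ ∧ action Ψ Φ mu u ≤ 2 * b + 1}}
  have hPclosed : IsClosed P := by
    have hP : P = {γ | γ 0 = 0} ∩ ({γ | γ 1 = u₀} ∩
        ⋂ t, {γ | γ t ∈ {u | Ψ u < ∞ ∧ action Ψ Φ mu u ≤ 2 * b + 1}}) := by
      ext γ
      simp [P]
    rw [hP]
    exact (isClosed_eq (by fun_prop) continuous_const).inter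
      ((isClosed_eq (by fun_prop) continuous_const).inter (isClosed_iInter fun t =>
        (isClosed_action_le h.lsc h.contDiff.continuous hmu0 _).preimage (by fun_prop)))
  have : CompleteSpace P := hPclosed.completeSpace_coe
  have hfin : ∀ γ ∈ P, ∀ t, Ψ (γ t) < ∞ := fun γ hγ t => (hγ.2.2 t).1
  have hbm : ∀ γ ∈ P, BddAbove (range fun t => action Ψ Φ mu (γ t)) := fun γ hγ =>
    ⟨2 * b + 1, by rintro _ ⟨t, rfl⟩; exact (hγ.2.2 t).2⟩
  have hbl : ∀ γ ∈ P, BddAbove (range fun t => action Ψ Φ lam (γ t)) := fun γ hγ =>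
    ⟨2 * b + 1, by rintro _ ⟨t, rfl⟩; exact (action_mono hlm _).trans (hγ.2.2 t).2⟩
  let A : P → ℝ := fun γ => ⨆ t, action Ψ Φ lam (γ.1 t)
  let B : P → ℝ := fun γ => ⨆ t, action Ψ Φ mu (γ.1 t)
  have hA : ∀ γ t, action Ψ Φ lam (γ.1 t) ≤ A γ := fun γ t => le_ciSup (hbl γ.1 γ.2) t
  have hB : ∀ γ t, action Ψ Φ mu (γ.1 t) ≤ B γ := fun γ t => le_ciSup (hbm γ.1 γ.2) t
  have hAmem : ∀ γ, A γ ∈ pathBounds Ψ Φ u₀ lam := fun γ =>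
    ⟨γ.1, γ.2.1, γ.2.2.1, fun t => ⟨hfin γ.1 γ.2 t, hA γ t⟩⟩
  have hBmem : ∀ γ, B γ ∈ pathBounds Ψ Φ u₀ mu := fun γ =>
    ⟨γ.1, γ.2.1, γ.2.2.1, fun t => ⟨hfin γ.1 γ.2 t, hB γ t⟩⟩
  have hAα : ∀ γ, α₀ ≤ A γ := fun γ => hMP.le_of_mem_pathBounds hlam (hAmem γ)
  have hBα : ∀ γ, α₀ ≤ B γ := fun γ => hMP.le_of_mem_pathBounds (hlam.trans hlm) (hBmem γ)
  have hAl : ∀ γ, level Ψ Φ u₀ lam ≤ A γ := fun γ =>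
    csInf_le (hMP.bddBelow_pathBounds hlam) (hAmem γ)
  have hBl : ∀ γ, level Ψ Φ u₀ mu ≤ B γ := fun γ =>
    csInf_le (hMP.bddBelow_pathBounds (hlam.trans hlm)) (hBmem γ)
  obtain ⟨a, ⟨γ₀, h0, h1, hγ₀⟩, hab⟩ := exists_lt_of_csInf_lt
    (h.pathBounds_nonempty hMP.endpoint_finite hmu0.le) hb
  have ha : α₀ ≤ a := hMP.le_of_mem_pathBounds (hlam.trans hlm) ⟨γ₀, h0, h1, hγ₀⟩
  have hγ₀P : γ₀ ∈ P := ⟨h0, h1, fun t => ⟨(hγ₀ t).1, (hγ₀ t).2.trans (by linarith)⟩⟩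
  obtain ⟨γ, hγle, hγ⟩ := exists_ekeland_point (f := fun γ : P => A γ + B γ)
    ((lowerSemicontinuous_iSup_action h.lsc h.contDiff.continuous hfin hlam0 hbl).add
      (lowerSemicontinuous_iSup_action h.lsc h.contDiff.continuous hfin hmu0 hbm))
    (m := 0) (fun γ => by linarith [hAα γ, hBα γ]) ⟨γ₀, hγ₀P⟩ (show 0 < η / (8 * R) by positivity)
  have hsum : A γ + B γ ≤ 2 * b := by
    have e1 : A ⟨γ₀, hγ₀P⟩ ≤ a := ciSup_le fun t => (action_mono hlm _).trans (hγ₀ t).2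
    have e2 : B ⟨γ₀, hγ₀P⟩ ≤ a := ciSup_le fun t => (hγ₀ t).2
    linarith
  by_contra! hcon
  have hend := hMP.action_endpoints_nonpos (hlm.trans hmu)
  obtain ⟨s₀, hs₀, hdef⟩ := h.exists_deformation hlam0 hmu0 (hfin γ.1 γ.2) hη hR (hA γ) (hB γ)
    (by rw [γ.2.1]; linarith [hAα γ]) (by rw [γ.2.2.1]; linarith [hAα γ]) fun t ht =>
      hcon (γ.1 t) (hfin γ.1 γ.2 t) (by linarith [hAl γ]) (by linarith [hA γ t, hBl γ])
        (by linarith [hB γ t, hAl γ])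
  -- the sum drops by at least `s η / 4`, while the distance penalty is at most `s η / 8`
  obtain ⟨s, hs, hss⟩ := exists_between (lt_min hs₀ (show 0 < 1 / η by positivity))
  obtain ⟨γ', e0, e1, hdist, hγ'⟩ := hdef s hs (hss.trans_le (min_le_left _ _))
  have hsη : s * η < 1 := by
    have := hss.trans_le (min_le_right _ _)
    rwa [lt_div_iff₀ hη] at this
  have hγ'P : γ' ∈ P := ⟨e0.trans γ.2.1, e1.trans γ.2.2.1, fun t =>
    ⟨(hγ' t).1, (hγ' t).2.2.trans (by linarith [hAα γ])⟩⟩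
  have f1 : A ⟨γ', hγ'P⟩ ≤ A γ - s * (3 / 4 * η) := ciSup_le fun t => (hγ' t).2.1
  have f2 : B ⟨γ', hγ'P⟩ ≤ B γ + s * (1 / 2 * η) := ciSup_le fun t => (hγ' t).2.2
  have f3 := hγ ⟨γ', hγ'P⟩
  have f4 : η / (8 * R) * dist γ ⟨γ', hγ'P⟩ ≤ s * η / 8 := by
    calc η / (8 * R) * dist γ ⟨γ', hγ'P⟩ ≤ η / (8 * R) * (s * R) := by gcongr; exact hdist
      _ = s * η / 8 := by field_simp
  have := mul_pos hs hη
  linarith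

/-! ### The monotonicity trick -/

/-- If the level has a finite upper derivative from the right at `λ`, then it is a critical level
of `I_λ`: the derivative bounds `Ψ` along a sequence of almost critical points. -/
theorem StandingAssumptions.exists_critical_of_right_deriv [CompleteSpace X]
    (h : StandingAssumptions Ψ Φ) (hcoer : Tendsto Ψ (Bornology.cobounded X) (𝓝 ∞))
    {ρ₀ α₀ ε : ℝ} {u₀ : X} (hMP : UniformMountainPassGeometry Ψ Φ ρ₀ α₀ ε u₀) {lam : ℝ}
    (hlam : 1 - ε ≤ lam) (hlam' : lam < 1 + ε) {C r : ℝ} (hr : 0 < r)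
    (hC : ∀ d, 0 < d → d < r → level Ψ Φ u₀ (lam + d) - level Ψ Φ u₀ lam ≤ C * d) :
    ∃ u, IsCriticalPoint Ψ Φ lam u ∧ Ψ u < ∞ ∧ action Ψ Φ lam u = level Ψ Φ u₀ lam := by
  have hlam0 : 0 < lam := by linarith [hMP.eps_lt_one]
  have hα := hMP.height_pos
  set q := min (r / 2) (min (1 + ε - lam) (α₀ / 4)) with hq
  have hq0 : 0 < q := lt_min (half_pos hr) (lt_min (by linarith) (by positivity))
  have hq1 : q ≤ r / 2 := min_le_left _ _
  have hq2 : q ≤ 1 + ε - lam := (min_le_right _ _).trans (min_le_left _ _)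
  have hq3 : q ≤ α₀ / 4 := (min_le_right _ _).trans (min_le_right _ _)
  let d : ℕ → ℝ := fun n => q * (1 / ((n : ℝ) + 1))
  have hd0 : ∀ n, 0 < d n := fun n => mul_pos hq0 Nat.one_div_pos_of_nat
  have hdq : ∀ n, d n ≤ q := fun n => by
    refine mul_le_of_le_one_right hq0.le ?_
    rw [div_le_one (by positivity)]
    linarith [Nat.cast_nonneg (α := ℝ) n]
  have hdlim : Tendsto d atTop (𝓝 0) := by
    simpa [d] using (tendsto_one_div_add_atTop_nhds_zero_nat (𝕜 := ℝ)).const_mul q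
  have hex := fun n : ℕ => h.exists_almost_critical hMP hlam (le_add_of_nonneg_right (hd0 n).le)
    (by linarith [hdq n]) (hd0 n) (by linarith [hdq n]) (Nat.cast_add_one_pos (α := ℝ) n)
    (lt_add_of_pos_right (level Ψ Φ u₀ (lam + d n)) (hd0 n))
  choose u hfin hlow hup hup' hcrit using hex
  have hlevel : ∀ n, level Ψ Φ u₀ (lam + d n) - level Ψ Φ u₀ lam ≤ C * d n := fun n =>
    hC (d n) (hd0 n) (by linarith [hdq n])
  have hΨ : ∀ n, (Ψ (u n)).toReal ≤ 2 * C + 6 := by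
    intro n
    refine le_of_mul_le_mul_left ?_ (hd0 n)
    have : d n * (Ψ (u n)).toReal = action Ψ Φ (lam + d n) (u n) - action Ψ Φ lam (u n) := by
      simp only [action]; ring
    linarith [hlow n, hup' n, hlevel n]
  have hbdd : Bornology.IsBounded (range u) := by
    have h1 := hcoer.eventually (lt_mem_nhds (ENNReal.ofReal_lt_top (r := 2 * C + 6)))
    refine (Bornology.isBounded_def.2 ?_ : Bornology.IsBounded
      {x | ENNReal.ofReal (2 * C + 6) < Ψ x}ᶜ).subset ?_
    · rw [compl_compl]
      exact h1
    · rintro _ ⟨n, rfl⟩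
      have := (ENNReal.le_ofReal_iff_toReal_le (hfin n).ne
        (ENNReal.toReal_nonneg.trans (hΨ n))).2 (hΨ n)
      simpa using this
  obtain ⟨φ, w, hφ, hnorm, hΨw, hw⟩ := h.exists_subseq_tendsto hbdd hfin hlam0
    (tendsto_const_nhds (x := lam)) (fun v hv e he => by
      obtain ⟨M, hM⟩ := hbdd.exists_norm_le
      have hnat := tendsto_natCast_atTop_atTop (R := ℝ).eventually_gt_atTop (‖v‖ + M)
      have hdv : Tendsto (fun n => d n * (Ψ v).toReal) atTop (𝓝 0) := by
        simpa using hdlim.mul_const (Ψ v).toReal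
      filter_upwards [hnat, hdlim.eventually (gt_mem_nhds he), hdv.eventually (gt_mem_nhds he)]
        with n e1 e2 e3
      have hRn : ‖v - u n‖ < n + 1 := by
        linarith [norm_sub_le v (u n), hM (u n) (mem_range_self n)]
      rcases hcrit n v hv hRn with hc | hc
      · linarith
      -- the defects for `λ + d n` and `λ` differ by `d n * (Ψ v - Ψ (u n)) ≤ d n * Ψ v`
      · have := mul_nonneg (hd0 n).le (ENNReal.toReal_nonneg (a := Ψ (u n)))
        simp only [defect] at hc ⊢
        linarith [hd0 n])
  refine ⟨w, hw, ((isCriticalPoint_iff hlam0).1 hw).1, ?_⟩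
  have hlim1 : Tendsto (fun j => action Ψ Φ lam (u (φ j))) atTop (𝓝 (action Ψ Φ lam w)) :=
    (hΨw.const_mul lam).sub ((h.contDiff.continuous.tendsto w).comp hnorm)
  have hlim2 : Tendsto (fun n => action Ψ Φ lam (u n)) atTop (𝓝 (level Ψ Φ u₀ lam)) := by
    refine tendsto_of_tendsto_of_tendsto_of_le_of_le
      (g := fun n => level Ψ Φ u₀ lam - 4 * d n) (h := fun n => level Ψ Φ u₀ lam + (C + 2) * d n)
      ?_ ?_ hlow fun n => ?_
    · simpa using (hdlim.const_mul 4).const_sub (level Ψ Φ u₀ lam)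
    · simpa using (hdlim.const_mul (C + 2)).const_add (level Ψ Φ u₀ lam)
    · change action Ψ Φ lam (u n) ≤ level Ψ Φ u₀ lam + (C + 2) * d n
      linarith [hup n, hlevel n]
  exact tendsto_nhds_unique hlim1 (hlim2.comp hφ.tendsto_atTop)

/-- Monotonicity of the level and Lebesgue's differentiation theorem make its values critical for
parameters arbitrarily close to `1`. -/
theorem StandingAssumptions.exists_critical_near_one [CompleteSpace X]
    (h : StandingAssumptions Ψ Φ) (hcoer : Tendsto Ψ (Bornology.cobounded X) (𝓝 ∞))
    {ρ₀ α₀ ε : ℝ} {u₀ : X} (hMP : UniformMountainPassGeometry Ψ Φ ρ₀ α₀ ε u₀) {δ : ℝ}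
    (hδ : 0 < δ) (hδε : δ ≤ ε) :
    ∃ lam ∈ Ioo 1 (1 + δ), ∃ u, IsCriticalPoint Ψ Φ lam u ∧ Ψ u < ∞ ∧
      action Ψ Φ lam u = level Ψ Φ u₀ lam := by
  have hmono : MonotoneOn (level Ψ Φ u₀) (Ioo 1 (1 + δ)) := fun x hx y _ hxy =>
    h.level_mono hMP (by linarith [hx.1]) hxy
  obtain ⟨lam, hlam, hdiff⟩ := (MeasureTheory.Measure.dense_of_ae
    hmono.ae_differentiableWithinAt_of_mem).exists_mem_open isOpen_Ioo
    (nonempty_Ioo.2 (show (1 : ℝ) < 1 + δ by linarith))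
  refine ⟨lam, hdiff, ?_⟩
  have hdiff' := (hlam hdiff).differentiableAt (isOpen_Ioo.mem_nhds hdiff)
  obtain ⟨C, hC⟩ := hdiff'.isBigO_sub.bound
  obtain ⟨r, hr, hball⟩ := Metric.eventually_nhds_iff.1 hC
  refine h.exists_critical_of_right_deriv hcoer hMP (by linarith [hdiff.1])
    (by linarith [hdiff.2]) hr (C := C) fun d hd hdr => ?_
  have := hball (y := lam + d) (by simpa [abs_of_pos hd] using hdr)
  simp only [Real.norm_eq_abs, add_sub_cancel_left, abs_of_pos hd] at this
  exact (le_abs_self _).trans this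

end Level

end MountainPass

theorem mainTheorem1 {X : Type*} [NormedAddCommGroup X] [NormedSpace ℝ X] [CompleteSpace X]
    (Ψ : X → ℝ≥0∞) (Φ : X → ℝ)
    -- `Ψ : X → [0,∞]` is lower semicontinuous and convex, and `Ψ 0 = 0`
    (hΨ_lsc : LowerSemicontinuous Ψ)
    (hΨ_convex : ConvexOn ℝ≥0 Set.univ Ψ)
    (hΨ_zero : Ψ 0 = 0)
    -- `Ψ u → ∞` as `‖u‖ → ∞`
    (hΨ_coercive : Tendsto Ψ (Bornology.cobounded X) (𝓝 ∞))
    -- weak convergence within the domain of `Ψ`, with convergence of `Ψ`, is strong convergence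
    (hΨ_strong : ∀ (u : ℕ → X) (w : X), (∀ j, Ψ (u j) < ∞) → Ψ w < ∞ →
      MountainPass.WeaklyConverges u w → Tendsto (fun j => Ψ (u j)) atTop (𝓝 (Ψ w)) →
      Tendsto (fun j => ‖u j - w‖) atTop (𝓝 0))
    -- `Φ` is of class `C¹`
    (hΦ_C1 : ContDiff ℝ 1 Φ)
    -- weak subsequential compactness of bounded sequences, with a liminf inequality for `Φ′`
    (hΦ_liminf : ∀ u : ℕ → X, Bornology.IsBounded (Set.range u) →
      ∃ (φ : ℕ → ℕ) (w : X), StrictMono φ ∧ MountainPass.WeaklyConverges (u ∘ φ) w ∧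
        ∀ v : X, ((fderiv ℝ Φ w (v - w) : ℝ) : EReal) ≤
          liminf (fun j => ((fderiv ℝ Φ (u (φ j)) (v - u (φ j)) : ℝ) : EReal)) atTop)
    -- boundedness of the critical sets
    (hIB : ∀ a b c : ℝ, 0 < a → a ≤ b →
      Bornology.IsBounded (MountainPass.criticalSet Ψ Φ a b c))
    -- uniform mountain pass geometry near `λ = 1`
    (ρ₀ α₀ ε : ℝ) (u₀ : X)
    (hMP : MountainPass.UniformMountainPassGeometry Ψ Φ ρ₀ α₀ ε u₀) :
    ∃ u : X, MountainPass.IsCriticalPoint Ψ Φ 1 u ∧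
      MountainPass.energy Ψ Φ 1 u = MountainPass.mountainPassLevel Ψ Φ u₀ 1 := by

  have h : MountainPass.StandingAssumptions Ψ Φ :=
    ⟨hΨ_lsc, hΨ_convex, hΨ_zero, hΨ_strong, hΦ_C1, hΦ_liminf⟩
  have hε := hMP.eps_pos
  have hε' := hMP.eps_lt_one
  let δ : ℕ → ℝ := fun n => ε * (1 / ((n : ℝ) + 1))
  have hδ0 : ∀ n, 0 < δ n := fun n => mul_pos hε Nat.one_div_pos_of_nat
  have hδε : ∀ n, δ n ≤ ε := fun n => by
    refine mul_le_of_le_one_right hε.le ?_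
    rw [div_le_one (by positivity)]
    linarith [Nat.cast_nonneg (α := ℝ) n]
  have hδlim : Tendsto δ atTop (𝓝 0) := by
    simpa [δ] using (tendsto_one_div_add_atTop_nhds_zero_nat (𝕜 := ℝ)).const_mul ε
  choose lam hlam u hcrit hfin hlevel using fun n =>
    h.exists_critical_near_one hΨ_coercive hMP (hδ0 n) (hδε n)
  have hlamlim : Tendsto lam atTop (𝓝 1) := by
    refine tendsto_of_tendsto_of_tendsto_of_le_of_le tendsto_const_nhds ?_
      (fun n => (hlam n).1.le) (fun n => (hlam n).2.le)
    simpa using hδlim.const_add 1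
  have hbdd : Bornology.IsBounded (range u) := by
    refine (hIB 1 (1 + ε) (MountainPass.level Ψ Φ u₀ (1 + ε)) one_pos (by linarith)).subset ?_
    rintro _ ⟨n, rfl⟩
    have hle : lam n ≤ 1 + ε := (hlam n).2.le.trans (by linarith [hδε n])
    refine ⟨lam n, ⟨(hlam n).1.le, hle⟩, hcrit n, ?_⟩
    rw [MountainPass.energy_eq_action (hfin n), hlevel n, EReal.coe_le_coe_iff]
    exact h.level_mono hMP (by linarith [(hlam n).1]) hle
  obtain ⟨φ, w, hφ, hnorm, hΨw, hw⟩ := h.exists_subseq_tendsto hbdd hfin one_pos hlamlim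
    fun v hv e he => Eventually.of_forall fun n => by
      have := ((MountainPass.isCriticalPoint_iff (zero_lt_one.trans (hlam n).1)).1 (hcrit n)).2 v hv
      linarith
  have hwfin := ((MountainPass.isCriticalPoint_iff one_pos).1 hw).1
  refine ⟨w, hw, ?_⟩
  rw [MountainPass.energy_eq_action hwfin, h.mountainPassLevel_eq hMP, EReal.coe_eq_coe_iff]
  have hlim1 : Tendsto (fun j => MountainPass.action Ψ Φ (lam (φ j)) (u (φ j))) atTop
      (𝓝 (MountainPass.action Ψ Φ 1 w)) :=
    ((hlamlim.comp hφ.tendsto_atTop).mul hΨw).sub ((hΦ_C1.continuous.tendsto w).comp hnorm)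
  have hlim2 := (h.tendsto_level hMP (fun n => (hlam n).1.le) hlamlim).comp hφ.tendsto_atTop
  refine tendsto_nhds_unique hlim1 (hlim2.congr fun j => ?_)
  exact (hlevel (φ j)).symm
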